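/- Let $A$ be a finite abelian group and $\emptyset\ne S\subseteq A$. Let $\mathrm{Haar}(A,S)$ be the graph on $\mathbb Z_2\times A$ with edges $(0,x)(1,x+s)$, and $\mathrm{Cay}(A,S)$ the digraph on $A$ with arcs $(x,x+s)$, where $x\in A$, $s\in S$. For $a\in A$, $\sigma\in S_A$ let $\bar a(0,x)=(0,x)$, $\bar a(1,x)=(1,x+a)$, $\hat\sigma(i,x)=(i,\sigma(x))$, $\tau(i,x)=(i+1,x)$, $\iota(i,x)=(i+1,-x)$, and $\mathrm{Iso}(A)=\{\tau^i\hat\alpha\bar g: i\in\{0,1\},\ \alpha\in\mathrm{Aut}(A),\ g\in A\}$. Write $\mathbb Z_2\ltimes\mathrm{Aut}(\mathrm{Cay}(A,T))$ for the permutation group of $\mathbb Z_2\times A$ generated by $\iota$ and all $\hat\gamma$ with $\gamma\in\mathrm{Aut}(\mathrm{Cay}(A,T))$. Call $\mathrm{Cay}(A,S)$ stable at $a$ if $\mathrm{Aut}(\mathrm{Haar}(A,S))=\bar a^{-1}(\mathbb Z_2\ltimes\mathrm{Aut}(\mathrm{Cay}(A,a+S)))\bar a$, unstable if it is stable at no $a\in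 A$, and nontrivially unstable if it is connected, not bipartite, twin-free and unstable. For finite abelian groups $B,E$ and $U\subseteq B$, a bijection $s:\mathbb Z_2\times B\to\mathbb Z_2\times E$ is normalized if $s(0,0)\in\{0\}\times E$ implies $s(0,0)=(0,0)$. A set $\mathcal S$ of normalized bijections solves the isomorphism problem for $\mathrm{Haar}(B,U)$ among the Haar graphs of $E$ if every Haar graph of $E$ isomorphic to $\mathrm{Haar}(B,U)$ equals $s(\mathrm{Haar}(B,U))$ for some $s\in\mathcal S$. A solving set for $\mathrm{Haar}(A,S)$ is such a set with $B=E=A$, $U=S$, that contains $\mathrm{Iso}(A)$. A solving set for $\mathrm{Cay}(A,T)$ is a set $\mathcal S\supseteq\mathrm{Aut}(A)$ of permutations of $A$ fixing $0$ such that every Cayley digraph of $A$ isomorphic to $\mathrm{Cay}(A,T)$ equals $s(\mathrm{Cay}(A,T))$ for some $s\in\mathcal S$. Suppose that $\mathrm{Cay}(A,S)$ is not nontrivially unstable, and let $\Gamma=\mathrm{Haar}(A,S)$. Then one of the following holds. (1) (Component.) $\Gamma$ is disconnected, there is $a\in A$ such that $(1,-a)$ lies in the component of $(0,0)$ in $\Gamma$,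 and for every such $a$, with $H=\langle (a+S)-(a+S)\rangle$: $\bar a(\Gamma)=\mathrm{Haar}(A,a+S)$, $H\ne A$, and the component of $(0,0)$ in $\bar a(\Gamma)$ has vertex set $\mathbb Z_2\times H$ and is $\mathrm{Haar}(H,a+S)$. For $K\le A$ and a bijection $s:\mathbb Z_2\times H\to\mathbb Z_2\times K$, a copy of $s$ is a permutation $t$ of $\mathbb Z_2\times A$ such that each coset of $H$ has a representative $x$ for which there is $y\in A$ with $t(i,x+h)=(j,y+k)$ whenever $i\in\mathbb Z_2$, $h\in H$ and $s(i,h)=(j,k)$. Every normalized $s$ has a normalized copy. If for each $K\le A$ the set $\mathcal S_K$ solves the isomorphism problem for $\mathrm{Haar}(H,a+S)$ among the Haar graphs of $K$, and $\mathcal T$ is any set of normalized copies of elements of $\bigcup_K\mathcal S_K$ that contains a copy of each of these elements, then $\mathrm{Iso}(A)\cup\{\bar b^{-1}t\,\bar a: b\in A,\ t\in\mathcal T\}$ is a solving set for $\Gamma$. (2) (Block quotient.) $\Gamma$ is connected and two distinct vertices of $\Gamma$ have the same neighbours. Let $C=\{c\in A:c+S=S\}$. Then $\mathrm{Aut}(\Gamma)$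 is transitive, the sets $\{i\}\times(x+C)$ form a system of nontrivial blocks of $\mathrm{Aut}(\Gamma)$, and the block quotient graph of $\Gamma$ is $\mathrm{Haar}(A/C,S/C)$, where $S/C$ is the image of $S$ in $A/C$. For $E\le A$ and a bijection $s:\mathbb Z_2\times A/C\to\mathbb Z_2\times A/E$, an extension of $s$ is a permutation $t$ of $\mathbb Z_2\times A$ that maps each set $\{i\}\times(x+C)$ onto the set $\{j\}\times(y+E)$ with $s(i,x+C)=(j,y+E)$. Every normalized $s$ has a normalized extension. If for each $E\le A$ the set $\mathcal S_E$ solves the isomorphism problem for $\mathrm{Haar}(A/C,S/C)$ among the Haar graphs of $A/E$, and $\mathcal T$ is any set of normalized extensions of elements of $\bigcup_E\mathcal S_E$ that contains an extension of each of these elements, then $\mathrm{Iso}(A)\cup\mathcal T$ is a solving set for $\Gamma$. (3) (Cayley digraph.) $\Gamma$ is connected, $\mathrm{Cay}(A,S)$ is stable at some $a\in A$, and for every such $a$ and every solving set $\mathcal S$ for $\mathrm{Cay}(A,a+S)$, the set $\mathrm{Iso}(A)\cup\{\bar b^{-1}\hat s\,\bar a: b\in A,\ s\in\mathcal S\}$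 is a solving set for $\Gamma$. -/

import Mathlib

open scoped Pointwise

namespace HaarIso

/-- The vertex set `ℤ₂ × A` of the Haar graphs of `A`. -/
abbrev Vtx (A : Type*) := ZMod 2 × A

/-- The Haar graph `Haar(A, S)`: the edges are the pairs `(0, x)(1, y)` with `y - x ∈ S`. -/
def haar {A : Type*} [AddCommGroup A] (S : Set A) : SimpleGraph (Vtx A) where
  Adj x y := (x.1 = 0 ∧ y.1 = 1 ∧ y.2 - x.2 ∈ S) ∨ (y.1 = 0 ∧ x.1 = 1 ∧ x.2 - y.2 ∈ S)
  symm := ⟨fun _ _ h => h.symm⟩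
  loopless := ⟨fun x h => by
    rcases h with ⟨h0, h1, -⟩ | ⟨h0, h1, -⟩ <;> rw [h0] at h1 <;> exact absurd h1 (by decide)⟩

/-- The Cayley digraph `Cay(A, S)`: the arcs are the pairs `(x, y)` with `y - x ∈ S`. -/
def cayley {A : Type*} [AddCommGroup A] (S : Set A) : Digraph A where
  Adj x y := y - x ∈ S

/-- The image `σ(Γ)` of a graph under a bijection of the vertex sets: `σ u` and `σ v` are
adjacent in `σ(Γ)` if and only if `u` and `v` are adjacent in `Γ`. -/
def image {V W : Type*} (σ : V ≃ W) (Γ : SimpleGraph V) : SimpleGraph W :=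
  Γ.comap σ.symm

/-- The image `σ(Δ)` of a digraph under a bijection of the vertex sets. -/
def diImage {V W : Type*} (σ : V ≃ W) (Δ : Digraph V) : Digraph W where
  Adj x y := Δ.Adj (σ.symm x) (σ.symm y)

/-- The automorphism group of a graph, as a permutation group on its vertices. -/
def autGroup {V : Type*} (Γ : SimpleGraph V) : Subgroup (Equiv.Perm V) where
  carrier := {σ | ∀ x y, Γ.Adj (σ x) (σ y) ↔ Γ.Adj x y}
  one_mem' := fun _ _ => Iff.rfl
  mul_mem' := fun {σ τ} hσ hτ x y => (hσ (τ x) (τ y)).trans (hτ x y)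
  inv_mem' := fun {σ} hσ x y => by
    have h := hσ (σ⁻¹ x) (σ⁻¹ y)
    simpa using h.symm

/-- The automorphism group of a digraph, as a permutation group on its vertices. -/
def diAutGroup {V : Type*} (Δ : Digraph V) : Subgroup (Equiv.Perm V) where
  carrier := {σ | ∀ x y, Δ.Adj (σ x) (σ y) ↔ Δ.Adj x y}
  one_mem' := fun _ _ => Iff.rfl
  mul_mem' := fun {σ τ} hσ hτ x y => (hσ (τ x) (τ y)).trans (hτ x y)
  inv_mem' := fun {σ} hσ x y => by
    have h := hσ (σ⁻¹ x) (σ⁻¹ y)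
    simpa using h.symm

/-! ### Permutations of `ℤ₂ × A` -/

/-- `σ̂ (i, x) = (i, σ x)`, as a homomorphism in `σ`. -/
def hat {A : Type*} : Equiv.Perm A →* Equiv.Perm (Vtx A) where
  toFun σ := (Equiv.refl (ZMod 2)).prodCongr σ
  map_one' := by ext x <;> rfl
  map_mul' := fun σ τ => by ext x <;> rfl

/-- `ā (0, x) = (0, x)` and `ā (1, x) = (1, x + a)`; with this sign `ā(Haar(A, S))` is
`Haar(A, a + S)`. -/
def bar {A : Type*} [AddCommGroup A] (a : A) : Equiv.Perm (Vtx A) where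
  toFun x := (x.1, if x.1 = 1 then x.2 + a else x.2)
  invFun x := (x.1, if x.1 = 1 then x.2 - a else x.2)
  left_inv x := by rcases x with ⟨i, x⟩; by_cases h : i = 1 <;> simp [h]
  right_inv x := by rcases x with ⟨i, x⟩; by_cases h : i = 1 <;> simp [h]

/-- `τ (i, x) = (i + 1, x)`. -/
def tau {A : Type*} : Equiv.Perm (Vtx A) :=
  (Equiv.addRight (1 : ZMod 2)).prodCongr (Equiv.refl A)

/-- `ι (i, x) = (i + 1, -x)`, an automorphism of every Haar graph of `A`. -/
def iota {A : Type*} [AddCommGroup A] : Equiv.Perm (Vtx A) :=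
  (Equiv.addRight (1 : ZMod 2)).prodCongr (Equiv.neg A)

/-- `Iso(A)`: all maps `τ ^ i * α̂ * ḡ` with `i ∈ ℤ₂`, `α ∈ Aut(A)`, `g ∈ A`. -/
def isoSet (A : Type*) [AddCommGroup A] : Set (Equiv.Perm (Vtx A)) :=
  {σ | ∃ (i : Fin 2) (α : A ≃+ A) (g : A), σ = tau ^ (i : ℕ) * hat α.toEquiv * bar g}

/-! ### Stability -/

/-- The permutation group `ℤ₂ ⋉ Aut(Cay(A, T))` on `ℤ₂ × A`: the group generated by `ι` and the
maps `γ̂` with `γ ∈ Aut(Cay(A, T))` (the former normalizes the group of the latter). -/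
def semidirect {A : Type*} [AddCommGroup A] (T : Set A) : Subgroup (Equiv.Perm (Vtx A)) :=
  Subgroup.zpowers iota ⊔ (diAutGroup (cayley T)).map hat

/-- `Aut(Haar(A, S)) = ā⁻¹ (ℤ₂ ⋉ Aut(Cay(A, a + S))) ā`. -/
def StableAt {A : Type*} [AddCommGroup A] (S : Set A) (a : A) : Prop :=
  autGroup (haar S) = (semidirect (a +ᵥ S)).map (MulAut.conj (bar a)⁻¹).toMonoidHom

/-- `Cay(A, S)` is unstable: `Aut(Haar(A, S))` is not of the form
`ā⁻¹ (ℤ₂ ⋉ Aut(Cay(A, a + S))) ā` with `a ∈ A`. -/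
def Unstable {A : Type*} [AddCommGroup A] (S : Set A) : Prop :=
  ¬ ∃ a : A, StableAt S a

/-- A digraph is connected if its underlying graph is. -/
def DiConnected {V : Type*} (Δ : Digraph V) : Prop :=
  (SimpleGraph.fromRel Δ.Adj).Connected

/-- A digraph is bipartite if it has a proper 2-colouring (so it has no loops). -/
def DiBipartite {V : Type*} (Δ : Digraph V) : Prop :=
  ∃ c : V → Bool, ∀ x y, Δ.Adj x y → c x ≠ c y

/-- No two distinct vertices of the digraph have the same out- and in-neighbours. -/
def DiTwinFree {V : Type*} (Δ : Digraph V) : Prop :=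
  ∀ u v, (∀ w, Δ.Adj u w ↔ Δ.Adj v w) → (∀ w, Δ.Adj w u ↔ Δ.Adj w v) → u = v

/-- `Cay(A, S)` is nontrivially unstable. -/
def NontriviallyUnstable {A : Type*} [AddCommGroup A] (S : Set A) : Prop :=
  DiConnected (cayley S) ∧ ¬ DiBipartite (cayley S) ∧ DiTwinFree (cayley S) ∧ Unstable S

/-- A graph is reducible if two distinct vertices have the same neighbours. -/
def Reducible {V : Type*} (Γ : SimpleGraph V) : Prop :=
  ∃ u v, u ≠ v ∧ ∀ w, Γ.Adj u w ↔ Γ.Adj v w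

/-! ### Solutions of isomorphism problems -/

/-- If `s (0, 0)` lies in `B₀ = {0} × E`, then `s (0, 0) = (0, 0)`. -/
def Normalized {B E : Type*} [AddCommGroup B] [AddCommGroup E] (s : Vtx B ≃ Vtx E) : Prop :=
  (s (0, 0)).1 = 0 → s (0, 0) = (0, 0)

/-- `𝒮` solves the isomorphism problem between `Haar(B, U)` and the Haar graphs of `E`: every Haar
graph of `E` that is isomorphic to `Haar(B, U)` is `s(Haar(B, U))` for some `s ∈ 𝒮`. -/
structure SolvesAmong {B E : Type*} [AddCommGroup B] [AddCommGroup E] (U : Set B)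
    (𝒮 : Set (Vtx B ≃ Vtx E)) : Prop where
  covers : ∀ V : Set E, Nonempty (haar U ≃g haar V) → ∃ s ∈ 𝒮, image s (haar U) = haar V
  normalized : ∀ s ∈ 𝒮, Normalized s

/-- `𝒯` is a solving set for `Haar(A, S)` in the class of Haar graphs of `A`. -/
structure IsSolvingSet {A : Type*} [AddCommGroup A] (S : Set A)
    (𝒯 : Set (Equiv.Perm (Vtx A))) : Prop extends SolvesAmong S 𝒯 where
  iso_subset : isoSet A ⊆ 𝒯

/-- `𝒮` is a solving set for `Cay(A, T)` in the class of Cayley digraphs of `A`. -/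
structure IsCayleySolvingSet {A : Type*} [AddCommGroup A] (T : Set A)
    (𝒮 : Set (Equiv.Perm A)) : Prop where
  covers : ∀ V : Set A, Nonempty ((cayley T).Adj ≃r (cayley V).Adj) →
    ∃ s ∈ 𝒮, diImage s (cayley T) = cayley V
  fixes_zero : ∀ s ∈ 𝒮, s 0 = 0
  aut_subset : ∀ α : A ≃+ A, α.toEquiv ∈ 𝒮

/-! ### Reduction to a component -/

/-- The subgroup `⟨T - T⟩` of `A`. -/
def diffSubgroup {A : Type*} [AddCommGroup A] (T : Set A) : AddSubgroup A :=
  AddSubgroup.closure (T - T)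

/-- `t` is a copy of `s` on each coset: `A` is partitioned into cosets `x + H`, and `t` maps
`ℤ₂ × (x + H)` onto some `ℤ₂ × (y + K)` in the way `s` maps `ℤ₂ × H` onto `ℤ₂ × K`, where `x` is
a suitable representative of its coset. -/
def IsCosetwise {A : Type*} [AddCommGroup A] (H K : AddSubgroup A) (s : Vtx H ≃ Vtx K)
    (t : Equiv.Perm (Vtx A)) : Prop :=
  ∀ z : A, ∃ x y : A, x - z ∈ H ∧
    ∀ (i : ZMod 2) (h : H), t (i, x + h) = ((s (i, h)).1, y + ((s (i, h)).2 : A))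

/-- The isomorphism problem for `Γ = Haar(A, S)` reduces to that for the component of
`ā(Γ) = Haar(A, a + S)` that contains `(0, 0)`. With `H = ⟨(a + S) - (a + S)⟩`, this component is
`Haar(H, a + S)`, where `H` is a proper subgroup of `A`. A solution of its isomorphism problem
consists of, for each subgroup `K` of `A`, a set `𝒮 K` of bijections that solves the isomorphism
problem between `Haar(H, a + S)` and the Haar graphs of `K` (which is empty unless
`|K| = |H|`). -/
structure ReducesToComponent {A : Type*} [AddCommGroup A] (S : Set A) (a : A) : Prop where
  image_eq : image (bar a) (haar S) = haar (a +ᵥ S)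
  proper : diffSubgroup (a +ᵥ S) ≠ ⊤
  component_supp : ((image (bar a) (haar S)).connectedComponentMk (0, 0)).supp =
    {x | x.2 ∈ diffSubgroup (a +ᵥ S)}
  component_eq : (image (bar a) (haar S)).comap
      (fun x : Vtx (diffSubgroup (a +ᵥ S)) => ((x.1, (x.2 : A)) : Vtx A)) =
    haar {h : diffSubgroup (a +ᵥ S) | (h : A) ∈ a +ᵥ S}
  exists_copy : ∀ (K : AddSubgroup A) (s : Vtx (diffSubgroup (a +ᵥ S)) ≃ Vtx K), Normalized s →
    ∃ t : Equiv.Perm (Vtx A), Normalized t ∧ IsCosetwise (diffSubgroup (a +ᵥ S)) K s t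
  solves : ∀ 𝒮 : (K : AddSubgroup A) → Set (Vtx (diffSubgroup (a +ᵥ S)) ≃ Vtx K),
    (∀ K, SolvesAmong {h : diffSubgroup (a +ᵥ S) | (h : A) ∈ a +ᵥ S} (𝒮 K)) →
    ∀ 𝒯 : Set (Equiv.Perm (Vtx A)),
      (∀ t ∈ 𝒯, Normalized t ∧
        ∃ K, ∃ s ∈ 𝒮 K, IsCosetwise (diffSubgroup (a +ᵥ S)) K s t) →
      (∀ K, ∀ s ∈ 𝒮 K, ∃ t ∈ 𝒯, IsCosetwise (diffSubgroup (a +ᵥ S)) K s t) →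
      IsSolvingSet S (isoSet A ∪ {σ | ∃ b : A, ∃ t ∈ 𝒯, σ = (bar b)⁻¹ * t * bar a})

/-! ### Reduction to a block quotient -/

/-- The projection `ℤ₂ × A → ℤ₂ × (A / C)`. -/
def proj {A : Type*} [AddCommGroup A] (C : AddSubgroup A) (x : Vtx A) : Vtx (A ⧸ C) :=
  (x.1, (x.2 : A ⧸ C))

/-- `S` as a set of cosets of `C`. -/
def cosets {A : Type*} [AddCommGroup A] (C : AddSubgroup A) (S : Set A) : Set (A ⧸ C) :=
  (fun x : A => (x : A ⧸ C)) '' S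

/-- The partition of `ℤ₂ × A` into the sets `{i} × (x + C)`. -/
def blocks {A : Type*} [AddCommGroup A] (C : AddSubgroup A) : Set (Set (Vtx A)) :=
  Set.range fun q : Vtx (A ⧸ C) => proj C ⁻¹' {q}

/-- The block quotient graph `Γ / 𝓑`. -/
def blockQuotient {V : Type*} (Γ : SimpleGraph V) (𝓑 : Set (Set V)) : SimpleGraph 𝓑 where
  Adj B B' := B ≠ B' ∧ ∃ u ∈ B.1, ∃ v ∈ B'.1, Γ.Adj u v
  symm := ⟨fun _ _ h => ⟨h.1.symm, by
    obtain ⟨-, u, hu, v, hv, huv⟩ := h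
    exact ⟨v, hv, u, hu, huv.symm⟩⟩⟩
  loopless := ⟨fun _ h => h.1 rfl⟩

/-- `t` is an extension of `s` to `ℤ₂ × A`: it maps the cosets of `C` to the cosets of `E`
as `s` does. -/
def IsExtension {A : Type*} [AddCommGroup A] (C E : AddSubgroup A)
    (s : Vtx (A ⧸ C) ≃ Vtx (A ⧸ E)) (t : Equiv.Perm (Vtx A)) : Prop :=
  ∀ x, proj E (t x) = s (proj C x)

/-- The largest subgroup `C` of `A` such that `S` is a union of cosets of `C`. -/
def period {A : Type*} [AddCommGroup A] (S : Set A) : AddSubgroup A :=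
  AddAction.stabilizer A S

/-- The isomorphism problem for `Γ = Haar(A, S)` reduces to that for its block quotient
`Haar(A / C, S / C)`, where `C ≠ 0` is the largest subgroup such that `S` is a union of cosets
of `C`. A solution of the isomorphism problem for the quotient consists of, for each subgroup `E`
of `A`, a set `𝒮 E` of bijections that solves the isomorphism problem between
`Haar(A / C, S / C)` and the Haar graphs of `A / E` (which is empty unless `|E| = |C|`). -/
structure ReducesToBlockQuotient {A : Type*} [AddCommGroup A] (S : Set A) : Prop where
  transitive : MulAction.IsPretransitive (autGroup (haar S)) (Vtx A)
  isBlockSystem : MulAction.IsBlockSystem (autGroup (haar S)) (blocks (period S))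
  nontrivial : ∀ B ∈ blocks (period S), ¬ MulAction.IsTrivialBlock B
  quotient_eq : ∃ e : haar (cosets (period S) S) ≃g blockQuotient (haar S) (blocks (period S)),
    ∀ q, (e q : Set (Vtx A)) = proj (period S) ⁻¹' {q}
  exists_extension : ∀ (E : AddSubgroup A) (s : Vtx (A ⧸ period S) ≃ Vtx (A ⧸ E)), Normalized s →
    ∃ t : Equiv.Perm (Vtx A), Normalized t ∧ IsExtension (period S) E s t
  solves : ∀ 𝒮 : (E : AddSubgroup A) → Set (Vtx (A ⧸ period S) ≃ Vtx (A ⧸ E)),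
    (∀ E, SolvesAmong (cosets (period S) S) (𝒮 E)) →
    ∀ 𝒯 : Set (Equiv.Perm (Vtx A)),
      (∀ t ∈ 𝒯, Normalized t ∧ ∃ E, ∃ s ∈ 𝒮 E, IsExtension (period S) E s t) →
      (∀ E, ∀ s ∈ 𝒮 E, ∃ t ∈ 𝒯, IsExtension (period S) E s t) →
      IsSolvingSet S (isoSet A ∪ 𝒯)

/-! ### Reduction to a Cayley digraph -/

/-- The isomorphism problem for `Haar(A, S)` reduces to that for the Cayley digraph
`Cay(A, a + S)`. -/
def ReducesToCayley {A : Type*} [AddCommGroup A] (S : Set A) (a : A) : Prop :=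
  ∀ 𝒮 : Set (Equiv.Perm A), IsCayleySolvingSet (a +ᵥ S) 𝒮 →
    IsSolvingSet S (isoSet A ∪ {σ | ∃ b : A, ∃ s ∈ 𝒮, σ = (bar b)⁻¹ * hat s * bar a})

end HaarIso

/-!
Write `Γ = Haar(A, S)` and `H = ⟨S - S⟩`. Every case starts from an isomorphism
`φ : Γ → Haar(A, V)` and replaces it by an isomorphism from the prescribed set. Haar graphs are
vertex-transitive (by translations and `ι`), and `b̄` maps `Haar(A, V)` onto `Haar(A, b + V)`, so
`φ` may be adjusted by these maps.

If `T` is nonempty and `T ⊆ ⟨T - T⟩`, then the components of `Haar(A, T)` are the sets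
`ℤ₂ × (x + ⟨T - T⟩)` (`reachable_iff`). It follows that `Γ` is connected if and only if `H = A`.

* If `Γ` is disconnected, then `a + S ⊆ H` whenever `(1, -a)` lies in the component of `(0, 0)`,
  and `V` has a translate contained in `K = ⟨V - V⟩`. With `S` and `V` replaced by these translates,
  `φ` composed with translations and `ι` induces an isomorphism of the components of `(0, 0)`,
  which are Haar graphs of `H` and `K` (`exists_subgroup_iso`). A solution
  for these, copied on each coset, is an isomorphism of the whole graphs
  (`IsCosetwise.image_haar_eq`).
* If two vertices have the same neighbours, then the classes of such vertices are the sets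
  `{i} × (x + C)` (`forall_adj_iff_proj_eq`), so `φ` induces an isomorphism of the quotients
  (`nonempty_quotient_iso`); conversely `Γ` is the pullback of its quotient
  (`haar_cosets_adj_proj`), so every extension of an isomorphism of the quotients is one of the
  graphs.
* Otherwise `H = A` makes `Cay(A, S)` connected and not bipartite, and twins of `Cay(A, S)` would be
  twins of `Γ`; as `Cay(A, S)` is not nontrivially unstable, it is stable at some `a`. Composing
  with `ι`, let `φ` preserve the halves, and put `ψ = φ ā⁻¹`. The translations of `A`, conjugated by
  `ψ`, are automorphisms of `Haar(A, a + S)`, which by stability act in the same way on both halves.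
  Hence the actions of `ψ` on the two halves differ by a constant (`StableAt.exists_snd_add_eq`),
  that is, `b̄ψ = f̂` for some `b` and some isomorphism `f : Cay(A, a + S) → Cay(A, b + V)`, and a
  solving set for `Cay(A, a + S)` applies.
-/

namespace HaarIso

theorem zmodTwo_cases (i : ZMod 2) : i = 0 ∨ i = 1 := by
  revert i; decide

/-! ### Haar graphs and their standard isomorphisms -/

section Basic

variable {A : Type*} [AddCommGroup A]

@[simp] theorem haar_adj_zero_one {S : Set A} {x y : A} :
    (haar S).Adj (0, x) (1, y) ↔ y - x ∈ S := by
  simp [haar]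

@[simp] theorem haar_adj_one_zero {S : Set A} {x y : A} :
    (haar S).Adj (1, x) (0, y) ↔ x - y ∈ S := by
  simp [haar]

@[simp] theorem not_haar_adj_zero_zero {S : Set A} {x y : A} :
    ¬ (haar S).Adj (0, x) (0, y) := by
  simp [haar]

@[simp] theorem not_haar_adj_one_one {S : Set A} {x y : A} :
    ¬ (haar S).Adj (1, x) (1, y) := by
  simp [haar]

theorem haar_adj_fst {S : Set A} {u v : Vtx A} (h : (haar S).Adj u v) : v.1 = u.1 + 1 := by
  rcases h with ⟨h0, h1, -⟩ | ⟨h0, h1, -⟩ <;> rw [h0, h1] <;> decide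

/-- `σ(Γ) = Γ'` means that `σ` is an isomorphism from `Γ` to `Γ'`. -/
theorem image_eq_iff {V W : Type*} {σ : V ≃ W} {Γ : SimpleGraph V} {Γ' : SimpleGraph W} :
    image σ Γ = Γ' ↔ ∀ x y, Γ'.Adj (σ x) (σ y) ↔ Γ.Adj x y := by
  constructor
  · rintro rfl x y
    simp [image]
  · intro h
    ext x y
    have := h (σ.symm x) (σ.symm y)
    simpa [image] using this.symm

@[simp] theorem bar_zero (a x : A) : bar a (0, x) = (0, x) := by
  simp [bar]

@[simp] theorem bar_one (a x : A) : bar a (1, x) = (1, x + a) := by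
  simp [bar]

@[simp] theorem bar_inv_fst (a : A) (u : Vtx A) : ((bar a)⁻¹ u).1 = u.1 := rfl

theorem bar_inv_zero (a x : A) : (bar a)⁻¹ (0, x) = (0, x) := by
  rw [Equiv.Perm.inv_eq_iff_eq, bar_zero]

@[simp] theorem hat_apply {A : Type*} (σ : Equiv.Perm A) (i : ZMod 2) (x : A) :
    hat σ (i, x) = (i, σ x) := rfl

@[simp] theorem iota_apply (i : ZMod 2) (x : A) : iota (i, x) = (i + 1, -x) := rfl

theorem haar_adj_bar (S : Set A) (a : A) (u v : Vtx A) :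
    (haar (a +ᵥ S)).Adj (bar a u) (bar a v) ↔ (haar S).Adj u v := by
  obtain ⟨i, x⟩ := u
  obtain ⟨j, y⟩ := v
  obtain rfl | rfl := zmodTwo_cases i <;> obtain rfl | rfl := zmodTwo_cases j <;>
    simp [Set.mem_vadd_set_iff_neg_vadd_mem] <;> abel_nf

/-- `ā` as an isomorphism from `Haar(A, S)` to `Haar(A, a + S)`. -/
def barIso (S : Set A) (a : A) : haar S ≃g haar (a +ᵥ S) where
  toEquiv := bar a
  map_rel_iff' := haar_adj_bar S a _ _

@[simp] theorem barIso_apply (S : Set A) (a : A) (u : Vtx A) : barIso S a u = bar a u := rfl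

/-- The translation `(i, x) ↦ (i, x + c)`, an automorphism of every Haar graph of `A`. -/
def translation (S : Set A) (c : A) : haar S ≃g haar S where
  toEquiv := hat (Equiv.addRight c)
  map_rel_iff' := by simp [haar]

@[simp] theorem translation_apply (S : Set A) (c : A) (i : ZMod 2) (x : A) :
    translation S c (i, x) = (i, x + c) := rfl

/-- `ι` as an automorphism of `Haar(A, S)`. -/
def iotaIso (S : Set A) : haar S ≃g haar S where
  toEquiv := iota
  map_rel_iff' := by
    rintro ⟨i, x⟩ ⟨j, y⟩
    obtain rfl | rfl := zmodTwo_cases i <;> obtain rfl | rfl := zmodTwo_cases j <;>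
      simp [CharTwo.add_self_eq_zero, add_comm, sub_eq_add_neg]

@[simp] theorem iotaIso_apply (S : Set A) (i : ZMod 2) (x : A) :
    iotaIso S (i, x) = (i + 1, -x) := rfl

theorem exists_iso_map_eq (S : Set A) (u v : Vtx A) : ∃ φ : haar S ≃g haar S, φ u = v := by
  obtain ⟨i, x⟩ := u
  obtain ⟨j, y⟩ := v
  by_cases h : j = i
  · exact ⟨translation S (y - x), by simp [h]⟩
  · refine ⟨(iotaIso S).trans (translation S (y + x)), ?_⟩
    have : i + 1 = j := by revert h; revert i j; decide
    simp [this]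

theorem nonempty_of_iso {B : Type*} [AddCommGroup B] {S : Set A} {V : Set B} (hS : S.Nonempty)
    (φ : haar S ≃g haar V) : V.Nonempty := by
  obtain ⟨s, hs⟩ := hS
  have h : (haar S).Adj (0, 0) (1, s) := by simpa using hs
  rcases φ.map_rel_iff.2 h with ⟨-, -, h⟩ | ⟨-, -, h⟩ <;> exact ⟨_, h⟩

theorem normalized_of_mem_isoSet {σ : Equiv.Perm (Vtx A)} (h : σ ∈ isoSet A) : Normalized σ := by
  obtain ⟨i, α, g, rfl⟩ := h
  fin_cases i <;> simp [Normalized, tau]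

theorem Normalized.bar_conj {t : Equiv.Perm (Vtx A)} (h : Normalized t) (a b : A) :
    Normalized ((bar b)⁻¹ * t * bar a) := by
  intro h0
  simp only [Equiv.Perm.mul_apply, bar_zero, bar_inv_fst] at h0 ⊢
  rw [h h0, bar_inv_zero]

/-- If `t` maps `Haar(A, a + S)` onto `Haar(A, b + V)`, then `b̄⁻¹ t ā` maps `Haar(A, S)` onto
`Haar(A, V)`. -/
theorem image_bar_conj {S V : Set A} {a b : A} {t : Equiv.Perm (Vtx A)}
    (h : image t (haar (a +ᵥ S)) = haar (b +ᵥ V)) :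
    image ((bar b)⁻¹ * t * bar a) (haar S) = haar V := by
  rw [image_eq_iff] at h ⊢
  intro u v
  rw [← haar_adj_bar S a, ← h, ← haar_adj_bar V b]
  simp

end Basic

/-! ### Components of Haar graphs -/

section Connectivity

variable {A : Type*} [AddCommGroup A]

theorem sub_mem_diffSubgroup {T : Set A} {s t : A} (hs : s ∈ T) (ht : t ∈ T) :
    s - t ∈ diffSubgroup T :=
  AddSubgroup.subset_closure (Set.sub_mem_sub hs ht)

/-- Since `T - T` is closed under negation, an induction over `⟨T - T⟩` needs only the step
`x ↦ x + (s - t)`. -/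
theorem diffSubgroup_induction {T : Set A} {P : A → Prop} (h0 : P 0)
    (h : ∀ x, ∀ s ∈ T, ∀ t ∈ T, P x → P (x + (s - t))) (x : A) (hx : x ∈ diffSubgroup T) :
    P x := by
  refine AddSubgroup.closure_induction_right (p := fun x _ => P x) h0 ?_ ?_ hx
  · rintro x y - ⟨s, hs, t, ht, rfl⟩ hP
    exact h x s hs t ht hP
  · rintro x y - ⟨s, hs, t, ht, rfl⟩ hP
    simpa using h x t ht s hs hP

theorem diffSubgroup_vadd (T : Set A) (a : A) : diffSubgroup (a +ᵥ T) = diffSubgroup T := by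
  unfold diffSubgroup
  congr 1
  ext x
  simp only [Set.mem_sub, Set.mem_vadd_set, vadd_eq_add]
  constructor
  · rintro ⟨_, ⟨s, hs, rfl⟩, _, ⟨t, ht, rfl⟩, rfl⟩
    exact ⟨s, hs, t, ht, by abel⟩
  · rintro ⟨s, hs, t, ht, rfl⟩
    exact ⟨_, ⟨s, hs, rfl⟩, _, ⟨t, ht, rfl⟩, by abel⟩

/-- If `T` lies in a subgroup `H`, then the second coordinate is constant modulo `H` on each
component of `Haar(A, T)`. -/
theorem sub_mem_of_reachable {T : Set A} {H : AddSubgroup A} (hT : T ⊆ H) {u v : Vtx A}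
    (h : (haar T).Reachable u v) : v.2 - u.2 ∈ H := by
  obtain ⟨p⟩ := h
  induction p with
  | nil => simp
  | @cons u v w h _ ih =>
    have h1 : v.2 - u.2 ∈ H := by
      rcases h with ⟨-, -, h⟩ | ⟨-, -, h⟩
      · exact hT h
      · rw [← neg_mem_iff, neg_sub]
        exact hT h
    simpa using H.add_mem ih h1

theorem reachable_zero_zero {T : Set A} (x : A) {h : A} (hh : h ∈ diffSubgroup T) :
    (haar T).Reachable (0, x) (0, x + h) := by
  refine diffSubgroup_induction (P := fun h => (haar T).Reachable (0, x) (0, x + h)) (by simp)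
    (fun y s hs t ht ih => ih.trans ?_) h hh
  have h1 : (haar T).Adj (0, x + y) (1, x + y + s) := by simpa using hs
  have h2 : (haar T).Adj (1, x + y + s) (0, x + (y + (s - t))) := by
    simp only [haar_adj_one_zero]
    convert ht using 1
    abel
  exact h1.reachable.trans h2.reachable

/-- For nonempty `T ⊆ H = ⟨T - T⟩`, the components of `Haar(A, T)` are the sets
`ℤ₂ × (x + H)`. -/
theorem reachable_iff {T : Set A} (hne : T.Nonempty) (hT : T ⊆ diffSubgroup T) {u v : Vtx A} :
    (haar T).Reachable u v ↔ v.2 - u.2 ∈ diffSubgroup T := by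
  refine ⟨sub_mem_of_reachable hT, fun h => ?_⟩
  obtain ⟨t, ht⟩ := hne
  -- every vertex `(i, x)` is joined to `(0, x)`
  have key : ∀ w : Vtx A, (haar T).Reachable w (0, w.2) := by
    rintro ⟨i, x⟩
    obtain rfl | rfl := zmodTwo_cases i
    · exact .refl _
    · have h1 : (haar T).Adj (1, x) (0, x - t) := by simpa using ht
      simpa using h1.reachable.trans (reachable_zero_zero (x - t) (hT ht))
  refine (key u).trans (.trans ?_ (key v).symm)
  simpa using reachable_zero_zero u.2 h

theorem neg_vadd_subset_diffSubgroup {T : Set A} {t : A} (ht : t ∈ T) :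
    -t +ᵥ T ⊆ (diffSubgroup T : Set A) := by
  rintro _ ⟨s, hs, rfl⟩
  simpa [neg_add_eq_sub] using sub_mem_diffSubgroup hs ht

/-- If `(1, -a)` lies in the component of `(0, 0)`, then `a + S` lies in `⟨(a + S) - (a + S)⟩`, so
that `reachable_iff` applies to `Haar(A, a + S)`. -/
theorem vadd_subset_of_reachable {S : Set A} (hS : S.Nonempty) {a : A}
    (h : (haar S).Reachable (0, 0) (1, -a)) : a +ᵥ S ⊆ (diffSubgroup (a +ᵥ S) : Set A) := by
  obtain ⟨t, ht⟩ := hS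
  -- `-t + S` lies in `⟨S - S⟩`, so its Haar graph detects components modulo this subgroup
  have h1 := sub_mem_of_reachable (neg_vadd_subset_diffSubgroup ht)
    (h.map (barIso S (-t)).toHom)
  have h2 : -a - t ∈ diffSubgroup S := by simpa [sub_eq_add_neg] using h1
  rw [diffSubgroup_vadd]
  rintro _ ⟨s, hs, rfl⟩
  have h3 := sub_mem (sub_mem_diffSubgroup hs ht) h2
  have : a + s = s - t - (-a - t) := by abel
  simpa [this] using h3

theorem connected_of_diffSubgroup_eq_top {S : Set A} (hS : S.Nonempty)
    (h : diffSubgroup S = ⊤) : (haar S).Connected := by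
  have : (haar S).Preconnected := fun u v => (reachable_iff hS (by simp [h])).2 (by simp [h])
  exact ⟨this⟩

theorem diffSubgroup_eq_top {S : Set A} (hS : S.Nonempty) (h : (haar S).Connected) :
    diffSubgroup S = ⊤ := by
  obtain ⟨t, ht⟩ := hS
  rw [eq_top_iff]
  intro x _
  have h1 := sub_mem_of_reachable (neg_vadd_subset_diffSubgroup ht)
    ((h.preconnected (0, 0) (0, x)).map (barIso S (-t)).toHom)
  simpa using h1

/-- An isomorphism from a connected Haar graph to a Haar graph preserves or exchanges the two
halves. -/
theorem exists_fst_eq_add {B : Type*} [AddCommGroup B] {S : Set A} {V : Set B}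
    (h : (haar S).Connected) (φ : haar S ≃g haar V) : ∃ j, ∀ u, (φ u).1 = u.1 + j := by
  refine ⟨(φ (0, 0)).1, fun u => ?_⟩
  obtain ⟨p⟩ := h.preconnected u (0, 0)
  suffices H : ∀ u v : Vtx A, (haar S).Walk u v → (φ u).1 = u.1 + ((φ v).1 - v.1) by
    simpa using H _ _ p
  intro u v p
  induction p with
  | nil => simp
  | @cons u v w h _ ih =>
    have h1 := haar_adj_fst h
    have h2 := haar_adj_fst (φ.map_rel_iff.2 h)
    rw [ih, h1] at h2
    exact add_right_cancel (h2.symm.trans (add_right_comm _ _ _))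

end Connectivity

/-! ### Stable Cayley digraphs -/

section Cayley

variable {A : Type*} [AddCommGroup A]

theorem diConnected_cayley {S : Set A} (h : diffSubgroup S = ⊤) : DiConnected (cayley S) := by
  have hadj : ∀ x, ∀ s ∈ S, (SimpleGraph.fromRel (cayley S).Adj).Reachable x (x + s) := by
    intro x s hs
    by_cases h0 : s = 0
    · simp [h0]
    · refine SimpleGraph.Adj.reachable ?_
      simp [SimpleGraph.fromRel_adj, cayley, h0, hs]
  have key : ∀ x, (SimpleGraph.fromRel (cayley S).Adj).Reachable 0 x := by
    refine fun x => diffSubgroup_induction (.refl _) (fun y s hs t ht ih => ?_) x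
      (h ▸ AddSubgroup.mem_top x)
    refine ih.trans ((hadj y s hs).trans ?_)
    have := (hadj (y + (s - t)) t ht).symm
    rwa [add_assoc, sub_add_cancel] at this
  have hpre : (SimpleGraph.fromRel (cayley S).Adj).Preconnected :=
    fun u v => (key u).symm.trans (key v)
  exact ⟨hpre⟩

theorem not_diBipartite_cayley {S : Set A} (hS : S.Nonempty) (h : diffSubgroup S = ⊤) :
    ¬ DiBipartite (cayley S) := by
  rintro ⟨c, hc⟩
  have hc' : ∀ x, ∀ s ∈ S, c (x + s) = !c x := by
    intro x s hs
    have := hc x (x + s) (by simpa [cayley] using hs)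
    revert this
    cases c x <;> cases c (x + s) <;> simp
  have key : ∀ x, c x = c 0 := by
    refine fun x => diffSubgroup_induction (P := fun x => c x = c 0) rfl
      (fun y s hs t ht ih => ?_) x (h ▸ AddSubgroup.mem_top x)
    have h1 := hc' y s hs
    have h2 := hc' (y + (s - t)) t ht
    rw [add_assoc, sub_add_cancel, h1] at h2
    rw [← ih]
    exact (Bool.not_inj h2).symm
  obtain ⟨s, hs⟩ := hS
  have := hc' 0 s hs
  rw [key] at this
  simp at this

theorem reducible_haar_of_not_diTwinFree {S : Set A} (h : ¬ DiTwinFree (cayley S)) :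
    Reducible (haar S) := by
  simp only [DiTwinFree, not_forall] at h
  obtain ⟨u, v, h1, -, hne⟩ := h
  refine ⟨(0, u), (0, v), by simpa using hne, ?_⟩
  rintro ⟨i, w⟩
  obtain rfl | rfl := zmodTwo_cases i
  · simp
  · simpa [cayley] using h1 w

/-- The elements of `ℤ₂ ⋉ Aut(Cay(A, T))` act on the second coordinate by a permutation that does
not depend on the first coordinate. -/
theorem exists_apply_of_mem_semidirect {T : Set A} {σ : Equiv.Perm (Vtx A)}
    (h : σ ∈ semidirect T) :
    ∃ (j : ZMod 2) (γ : Equiv.Perm A), ∀ i x, σ (i, x) = (i + j, γ x) := by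
  -- the permutations of this form are a group, which contains the generators
  let G : Subgroup (Equiv.Perm (Vtx A)) :=
    { carrier := {σ | ∃ (j : ZMod 2) (γ : Equiv.Perm A), ∀ i x, σ (i, x) = (i + j, γ x)}
      one_mem' := ⟨0, 1, by simp⟩
      mul_mem' := by
        rintro σ τ ⟨j, γ, h⟩ ⟨k, δ, h'⟩
        exact ⟨k + j, γ * δ, fun i x => by simp [h, h', add_assoc]⟩
      inv_mem' := by
        rintro σ ⟨j, γ, h⟩
        refine ⟨-j, γ⁻¹, fun i x => ?_⟩
        rw [Equiv.Perm.inv_eq_iff_eq, h, neg_add_cancel_right]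
        simp }
  suffices semidirect T ≤ G from this h
  refine sup_le ?_ ?_
  · rw [Subgroup.zpowers_le]
    exact ⟨1, Equiv.neg A, fun i x => rfl⟩
  · rintro _ ⟨γ, -, rfl⟩
    exact ⟨0, γ, fun i x => by simp⟩

/-- An isomorphism `ψ` from `Haar(A, a + S)` that preserves the halves has the form `b̄⁻¹ f̂`,
because the translations of the target, conjugated by `ψ`, act in the same way on both halves. -/
theorem StableAt.exists_snd_add_eq {S V : Set A} {a : A} (h : StableAt S a)
    (ψ : haar (a +ᵥ S) ≃g haar V) (hψ : ∀ u, (ψ u).1 = u.1) :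
    ∃ b, ∀ x, (ψ (1, x)).2 + b = (ψ (0, x)).2 := by
  have key : ∀ c, ∃ γ : Equiv.Perm A, ∀ i x, (ψ (i, γ x)).2 = (ψ (i, x)).2 + c := by
    intro c
    -- the translation by `c`, conjugated by `ψ`
    let θ : haar (a +ᵥ S) ≃g haar (a +ᵥ S) := (ψ.trans (translation V c)).trans ψ.symm
    have hσ : ((barIso S a).trans (θ.trans (barIso S a).symm)).toEquiv ∈ autGroup (haar S) :=
      fun x y => ((barIso S a).trans (θ.trans (barIso S a).symm)).map_rel_iff
    rw [h] at hσ
    obtain ⟨ρ, hρ, hρσ⟩ := hσ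
    obtain ⟨j, γ, hγ⟩ := exists_apply_of_mem_semidirect hρ
    have hρθ : ∀ u, ρ u = θ u := by
      intro u
      have h1 := DFunLike.congr_fun hρσ ((bar a)⁻¹ u)
      have h2 : (bar a)⁻¹ (ρ u) = (bar a)⁻¹ (θ u) := by
        have h3 : (bar a)⁻¹ (ρ u) = (barIso S a).symm (θ (bar a ((bar a)⁻¹ u))) := by
          simpa using h1
        rwa [show bar a ((bar a)⁻¹ u) = u by simp] at h3
      exact (bar a)⁻¹.injective h2
    refine ⟨γ, fun i x => ?_⟩
    have h1 : ψ (ρ (i, x)) = ((ψ (i, x)).1, (ψ (i, x)).2 + c) := by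
      rw [hρθ]
      exact ψ.apply_symm_apply _
    rw [hγ] at h1
    have h2 := congrArg Prod.fst h1
    simp only [hψ] at h2
    rw [h2] at h1
    exact congrArg Prod.snd h1
  refine ⟨(ψ (0, 0)).2 - (ψ (1, 0)).2, fun x => ?_⟩
  obtain ⟨γ, hγ⟩ := key ((ψ (0, x)).2 - (ψ (0, 0)).2)
  -- the conjugated translation that maps `(0, 0)` to `(0, x)` maps `(1, 0)` to `(1, x)`
  have h0 : γ 0 = x := by
    have : ψ (0, γ 0) = ψ (0, x) := by
      refine Prod.ext (by simp [hψ]) ?_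
      rw [hγ]
      abel
    simpa using ψ.injective this
  have h1 := hγ 1 0
  rw [h0] at h1
  rw [h1]
  abel

/-- Stability yields the reduction for every connected Haar graph, whether or not it has vertices
with the same neighbours. -/
theorem StableAt.reducesToCayley {S : Set A} {a : A} (hS : (haar S).Connected)
    (h : StableAt S a) : ReducesToCayley S a := by
  intro 𝒮 h𝒮
  refine ⟨⟨?_, ?_⟩, Set.subset_union_left⟩
  · rintro V ⟨φ⟩
    -- if `φ` exchanges the halves, compose it with `ι`
    obtain ⟨ψ, hψ⟩ : ∃ ψ : haar (a +ᵥ S) ≃g haar V, ∀ u, (ψ u).1 = u.1 := by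
      obtain ⟨j, hj⟩ := exists_fst_eq_add hS φ
      obtain rfl | rfl := zmodTwo_cases j
      · refine ⟨(barIso S a).symm.trans φ, fun u => ?_⟩
        rw [RelIso.trans_apply, hj, add_zero]
        rfl
      · refine ⟨((barIso S a).symm.trans φ).trans (iotaIso V), fun u => ?_⟩
        have h1 : (φ ((barIso S a).symm u)).1 + 1 = u.1 := by
          rw [hj, add_assoc, CharTwo.add_self_eq_zero, add_zero]
          rfl
        exact h1
    obtain ⟨b, hb⟩ := h.exists_snd_add_eq ψ hψ
    have hf : Function.Bijective fun x => (ψ (0, x)).2 := by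
      constructor
      · intro x y hxy
        have : ψ (0, x) = ψ (0, y) := Prod.ext (by simp [hψ]) hxy
        simpa using ψ.injective this
      · intro y
        obtain ⟨⟨i, x⟩, hx⟩ := ψ.surjective (0, y)
        have : i = 0 := by simpa [hx] using (hψ (i, x)).symm
        subst this
        exact ⟨x, by simp [hx]⟩
    have hiso : ∀ x y, (cayley (b +ᵥ V)).Adj (ψ (0, x)).2 (ψ (0, y)).2 ↔
        (cayley (a +ᵥ S)).Adj x y := by
      intro x y
      have h1 := ψ.map_rel_iff (a := (0, x)) (b := (1, y))
      have e0 : ψ (0, x) = (0, (ψ (0, x)).2) := Prod.ext (hψ _) rfl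
      have e1 : ψ (1, y) = (1, (ψ (1, y)).2) := Prod.ext (hψ _) rfl
      rw [e0, e1, haar_adj_zero_one, haar_adj_zero_one] at h1
      simp only [cayley]
      rw [← h1, ← hb y, Set.mem_vadd_set_iff_neg_vadd_mem, vadd_eq_add]
      abel_nf
    obtain ⟨s, hs, hsV⟩ := h𝒮.covers (b +ᵥ V)
      ⟨⟨Equiv.ofBijective _ hf, fun {x y} => hiso x y⟩⟩
    refine ⟨_, Or.inr ⟨b, s, hs, rfl⟩, image_bar_conj (image_eq_iff.2 ?_)⟩
    have hs' : ∀ x y, s y - s x ∈ b +ᵥ V ↔ y - x ∈ a +ᵥ S := by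
      intro x y
      have h1 : (cayley (b +ᵥ V)).Adj (s x) (s y) ↔ (cayley (a +ᵥ S)).Adj x y := by
        rw [← hsV]
        simp [diImage]
      exact h1
    rintro ⟨i, x⟩ ⟨j, y⟩
    obtain rfl | rfl := zmodTwo_cases i <;> obtain rfl | rfl := zmodTwo_cases j <;> simp [hs']
  · rintro σ (hσ | ⟨b, s, hs, rfl⟩)
    · exact normalized_of_mem_isoSet hσ
    · refine Normalized.bar_conj (fun _ => ?_) a b
      simp [h𝒮.fixes_zero s hs]

end Cayley

/-! ### Permutations built from subgroups and quotients -/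

section Splitting

variable {A : Type*} [AddCommGroup A]

/-- A choice of coset representatives of `C`, with `0` representing `C`, as a bijection. -/
theorem exists_split (C : AddSubgroup A) :
    ∃ f : (A ⧸ C) × C ≃ A, f (0, 0) = 0 ∧ (∀ q c, ((f (q, c) : A) : A ⧸ C) = q) ∧
      ∀ q c, f (q, c) = f (q, 0) + c := by
  classical
  let r : A ⧸ C → A := Function.update Quotient.out 0 0
  have hr : ∀ q : A ⧸ C, ((r q : A) : A ⧸ C) = q := by
    intro q
    by_cases h : q = 0
    · simp [r, h]
    · simp [r, h]
  have hq : ∀ q (c : C), ((r q + c : A) : A ⧸ C) = q := by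
    intro q c
    rw [QuotientAddGroup.mk_add, (QuotientAddGroup.eq_zero_iff (c : A)).2 c.2, add_zero, hr]
  have hbij : Function.Bijective fun p : (A ⧸ C) × C => r p.1 + p.2 := by
    constructor
    · rintro ⟨q, c⟩ ⟨q', c'⟩ h
      have h1 : q = q' := by
        rw [← hq q c, ← hq q' c']
        exact congrArg _ h
      subst h1
      simpa using h
    · intro x
      refine ⟨(x, ⟨-r x + x, QuotientAddGroup.eq.1 (hr x)⟩), by simp⟩
  refine ⟨Equiv.ofBijective _ hbij, ?_, hq, ?_⟩
  · simp [r]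
  · intro q c
    simp

theorem exists_equiv_zero {X Y : Type*} [Zero X] [AddGroup Y] [Finite X] [Finite Y]
    (h : Nat.card X = Nat.card Y) : ∃ e : X ≃ Y, e 0 = 0 := by
  obtain ⟨e⟩ := (Finite.card_eq (α := X) (β := Y)).1 h
  exact ⟨e.trans (Equiv.addRight (-e 0)), by simp⟩

/-- `t` acts as `s` on the cosets and as a bijection `C → E` with `0 ↦ 0` inside them. -/
theorem exists_isExtension [Finite A] (C E : AddSubgroup A) (s : Vtx (A ⧸ C) ≃ Vtx (A ⧸ E))
    (hs : Normalized s) : ∃ t : Equiv.Perm (Vtx A), Normalized t ∧ IsExtension C E s t := by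
  have hcard : Nat.card C = Nat.card E := by
    have h1 := Nat.card_congr s
    simp only [Nat.card_prod] at h1
    have h2 : Nat.card (A ⧸ C) = Nat.card (A ⧸ E) := by simpa using h1
    have h3 := C.card_eq_card_quotient_mul_card_addSubgroup
    rw [E.card_eq_card_quotient_mul_card_addSubgroup, h2] at h3
    exact (Nat.eq_of_mul_eq_mul_left Nat.card_pos h3).symm
  obtain ⟨e, he⟩ := exists_equiv_zero hcard
  obtain ⟨f, hf0, hf, -⟩ := exists_split C
  obtain ⟨g, hg0, hg, -⟩ := exists_split E
  let F : Vtx (A ⧸ C) × C ≃ Vtx A := (Equiv.prodAssoc _ _ _).trans ((Equiv.refl _).prodCongr f)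
  let G : Vtx (A ⧸ E) × E ≃ Vtx A := (Equiv.prodAssoc _ _ _).trans ((Equiv.refl _).prodCongr g)
  let t : Equiv.Perm (Vtx A) := (F.symm.trans (s.prodCongr e)).trans G
  have htF : ∀ q c, t (F (q, c)) = G (s q, e c) := fun q c => by simp [t]
  refine ⟨t, ?_, ?_⟩
  · have h0 : ((0, 0) : Vtx A) = F ((0, 0), 0) := by simp [F, hf0]
    intro h
    rw [h0, htF, he] at h ⊢
    rw [← h0, hs h]
    simp [G, hg0]
  · intro x
    obtain ⟨⟨⟨i, q⟩, c⟩, rfl⟩ := F.surjective x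
    rw [htF]
    simp [F, G, proj, hf, hg]

/-- `t` acts as `s` inside the cosets and as a bijection `A / H → A / K` with `0 ↦ 0` on them. -/
theorem exists_isCosetwise [Finite A] (H K : AddSubgroup A) (s : Vtx H ≃ Vtx K)
    (hs : Normalized s) : ∃ t : Equiv.Perm (Vtx A), Normalized t ∧ IsCosetwise H K s t := by
  have hcard : Nat.card (A ⧸ H) = Nat.card (A ⧸ K) := by
    have h1 := Nat.card_congr s
    simp only [Nat.card_prod] at h1
    have h2 : Nat.card H = Nat.card K := by simpa using h1
    have h3 := H.card_eq_card_quotient_mul_card_addSubgroup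
    rw [K.card_eq_card_quotient_mul_card_addSubgroup, h2] at h3
    exact (Nat.eq_of_mul_eq_mul_right Nat.card_pos h3).symm
  obtain ⟨e, he⟩ := exists_equiv_zero hcard
  obtain ⟨f, hf0, hf, hfa⟩ := exists_split H
  obtain ⟨g, hg0, -, hga⟩ := exists_split K
  let F : (A ⧸ H) × Vtx H ≃ Vtx A :=
    ((Equiv.prodAssoc _ _ _).symm.trans ((Equiv.prodComm _ _).prodCongr (Equiv.refl _))).trans
      ((Equiv.prodAssoc _ _ _).trans ((Equiv.refl _).prodCongr f))
  let G : (A ⧸ K) × Vtx K ≃ Vtx A :=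
    ((Equiv.prodAssoc _ _ _).symm.trans ((Equiv.prodComm _ _).prodCongr (Equiv.refl _))).trans
      ((Equiv.prodAssoc _ _ _).trans ((Equiv.refl _).prodCongr g))
  let t : Equiv.Perm (Vtx A) := (F.symm.trans (e.prodCongr s)).trans G
  have htF : ∀ q w, t (F (q, w)) = G (e q, s w) := fun q w => by simp [t]
  refine ⟨t, ?_, ?_⟩
  · have h0 : ((0, 0) : Vtx A) = F (0, (0, 0)) := by simp [F, hf0]
    intro h
    rw [h0, htF, he] at h ⊢
    rw [← h0, hs h]
    simp [G, hg0]
  · intro z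
    refine ⟨f (z, 0), g (e z, 0), ?_, fun i h => ?_⟩
    · have h1 := QuotientAddGroup.eq.1 (hf z 0).symm
      rwa [neg_add_eq_sub] at h1
    · rw [← hfa, ← hga]
      exact htF z (i, h)

end Splitting

/-! ### Reduction to a component -/

section Component

variable {A : Type*} [AddCommGroup A]

/-- A copy of an isomorphism `Haar(H, U) → Haar(K, V)` on each coset of `H` is an isomorphism
`Haar(A, U) → Haar(A, V)`. -/
theorem IsCosetwise.image_haar_eq {H K : AddSubgroup A} {U V : Set A} (hU : U ⊆ H) (hV : V ⊆ K)
    {s : Vtx H ≃ Vtx K} {t : Equiv.Perm (Vtx A)} (ht : IsCosetwise H K s t)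
    (hs : image s (haar {h : H | (h : A) ∈ U}) = haar {k : K | (k : A) ∈ V}) :
    image t (haar U) = haar V := by
  rw [image_eq_iff] at hs ⊢
  rintro ⟨i, z⟩ ⟨j, w⟩
  obtain ⟨x, y, hxz, hxy⟩ := ht z
  have snd_sub : ∀ {L : AddSubgroup A} {T : Set A}, T ⊆ L → ∀ {u v : Vtx A}, (haar T).Adj u v →
      v.2 - u.2 ∈ L := fun hT _ _ h => sub_mem_of_reachable hT h.reachable
  obtain ⟨h, rfl⟩ : ∃ h : H, x + h = z := ⟨⟨z - x, by simpa using neg_mem hxz⟩, by simp⟩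
  -- an edge on either side forces both end points into the same coset of `H`
  have hw : (haar V).Adj (t (i, x + h)) (t (j, w)) ∨ (haar U).Adj (i, x + h) (j, w) →
      ∃ h' : H, x + h' = w := by
    rintro (hadj | hadj)
    · have h1 := snd_sub hV hadj
      rw [hxy] at h1
      obtain ⟨k, hk⟩ : ∃ k : K, (t (j, w)).2 = y + k := by
        refine ⟨⟨_, add_mem h1 (s (i, h)).2.2⟩, ?_⟩
        change _ = y + ((t (j, w)).2 - (y + (s (i, h)).2) + (s (i, h)).2)
        abel
      have h2 : t (j, w) = t ((s.symm ((t (j, w)).1, k)).1, x + (s.symm ((t (j, w)).1, k)).2) := by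
        rw [hxy]
        simp [← hk]
      exact ⟨_, (congrArg Prod.snd (t.injective h2)).symm⟩
    · have h1 := add_mem (snd_sub hU hadj) h.2
      refine ⟨⟨_, h1⟩, ?_⟩
      change x + (w - (x + h) + h) = w
      abel
  by_cases hex : ∃ h' : H, x + h' = w
  · obtain ⟨h', rfl⟩ := hex
    have comap : ∀ {L : AddSubgroup A} (T : Set A) (c : A) (u v : Vtx L),
        (haar T).Adj (u.1, c + u.2) (v.1, c + v.2) ↔ (haar {l : L | (l : A) ∈ T}).Adj u v := by
      intro L T c u v
      simp [haar]
    rw [hxy, hxy, comap, comap U x (i, h) (j, h')]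
    exact hs _ _
  · exact ⟨fun h1 => absurd (hw (.inl h1)) hex, fun h1 => absurd (hw (.inr h1)) hex⟩

/-- An isomorphism of Haar graphs, composed with an automorphism that makes it fix `(0, 0)`, maps
the component of `(0, 0)` to the component of `(0, 0)`. -/
theorem exists_subgroup_iso {S V : Set A} (hS : S.Nonempty) (hV : V.Nonempty)
    (hSH : S ⊆ diffSubgroup S) (hVK : V ⊆ diffSubgroup V) (φ : haar S ≃g haar V) :
    Nonempty (haar {h : diffSubgroup S | (h : A) ∈ S} ≃g
      haar {k : diffSubgroup V | (k : A) ∈ V}) := by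
  obtain ⟨ρ, hρ⟩ := exists_iso_map_eq V (φ (0, 0)) (0, 0)
  let ψ := φ.trans ρ
  have hψ0 : ψ (0, 0) = (0, 0) := hρ
  have hψ : ∀ u, u.2 ∈ diffSubgroup S ↔ (ψ u).2 ∈ diffSubgroup V := by
    intro u
    have h1 := reachable_iff hS hSH (u := (0, 0)) (v := u)
    have h2 := reachable_iff hV hVK (u := (0, 0)) (v := ψ u)
    rw [sub_zero] at h1 h2
    rw [← h1, ← h2]
    nth_rewrite 2 [← hψ0]
    exact (SimpleGraph.Iso.reachable_iff (φ := ψ)).symm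
  have ext' : ∀ {L : AddSubgroup A} {u v : Vtx L}, u.1 = v.1 → (u.2 : A) = v.2 → u = v :=
    fun h1 h2 => Prod.ext h1 (Subtype.ext h2)
  refine ⟨⟨⟨fun u => ((ψ (u.1, u.2)).1, ⟨(ψ (u.1, u.2)).2, (hψ _).1 u.2.2⟩),
    fun v => ((ψ.symm (v.1, v.2)).1, ⟨(ψ.symm (v.1, v.2)).2, (hψ _).2 ?_⟩), ?_, ?_⟩, ?_⟩⟩
  · rw [RelIso.apply_symm_apply]
    exact v.2.2
  · exact fun u => ext' (by simp) (by simp)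
  · exact fun u => ext' (by simp) (by simp)
  · intro u v
    exact ψ.map_rel_iff (a := (u.1, u.2)) (b := (v.1, v.2))

theorem reducesToComponent [Finite A] {S : Set A} (hS : S.Nonempty) (hcon : ¬ (haar S).Connected)
    {a : A} (ha : (haar S).Reachable (0, 0) (1, -a)) : ReducesToComponent S a := by
  have hsub := vadd_subset_of_reachable hS ha
  have himage : image (bar a) (haar S) = haar (a +ᵥ S) := image_eq_iff.2 (haar_adj_bar S a)
  refine ⟨himage, ?_, ?_, ?_, fun K s => exists_isCosetwise _ K s, ?_⟩
  · intro h
    rw [diffSubgroup_vadd] at h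
    exact hcon (connected_of_diffSubgroup_eq_top hS h)
  · rw [himage]
    ext u
    rw [SimpleGraph.ConnectedComponent.mem_supp_iff, SimpleGraph.ConnectedComponent.eq,
      SimpleGraph.reachable_comm, reachable_iff hS.vadd_set hsub, sub_zero]
    rfl
  · rw [himage]
    ext u v
    simp [haar]
  · intro 𝒮 h𝒮 𝒯 h𝒯 hcopy
    refine ⟨⟨?_, ?_⟩, Set.subset_union_left⟩
    · rintro V ⟨φ⟩
      obtain ⟨v, hv⟩ := nonempty_of_iso hS φ
      have hVK : -v +ᵥ V ⊆ (diffSubgroup (-v +ᵥ V) : Set A) := by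
        rw [diffSubgroup_vadd]
        exact neg_vadd_subset_diffSubgroup hv
      obtain ⟨s, hs, hsV⟩ := (h𝒮 _).covers _ (exists_subgroup_iso hS.vadd_set
        (Set.Nonempty.vadd_set ⟨v, hv⟩) hsub hVK
        (((barIso S a).symm.trans φ).trans (barIso V (-v))))
      obtain ⟨t, ht, hst⟩ := hcopy _ s hs
      exact ⟨_, Or.inr ⟨-v, t, ht, rfl⟩, image_bar_conj (hst.image_haar_eq hsub hVK hsV)⟩
    · rintro σ (hσ | ⟨b, t, ht, rfl⟩)
      · exact normalized_of_mem_isoSet hσ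
      · exact (h𝒯 t ht).1.bar_conj a b

end Component

/-! ### Reduction to the block quotient -/

section BlockQuotient

variable {A : Type*} [AddCommGroup A]

theorem proj_surjective (C : AddSubgroup A) : Function.Surjective (proj C) := by
  rintro ⟨i, q⟩
  obtain ⟨x, rfl⟩ := QuotientAddGroup.mk_surjective q
  exact ⟨(i, x), rfl⟩

theorem mem_period_iff {S : Set A} {c : A} : c ∈ period S ↔ ∀ x, c + x ∈ S ↔ x ∈ S := by
  rw [period, AddAction.mem_stabilizer_iff]
  constructor
  · intro h x
    nth_rewrite 1 [← h]
    exact Set.vadd_mem_vadd_set_iff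
  · intro h
    ext x
    rw [Set.mem_vadd_set_iff_neg_vadd_mem, vadd_eq_add, ← h, add_neg_cancel_left]

theorem mk_mem_cosets_period {S : Set A} {x : A} :
    (x : A ⧸ period S) ∈ cosets (period S) S ↔ x ∈ S := by
  constructor
  · rintro ⟨y, hy, hyx⟩
    have h := mem_period_iff.1 (QuotientAddGroup.eq.1 hyx) y
    rw [neg_add_eq_sub, sub_add_cancel] at h
    exact h.2 hy
  · exact fun h => ⟨x, h, rfl⟩

/-- `Haar(A, S)` is the pullback of `Haar(A / C, S / C)` for the period `C` of `S`. -/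
theorem haar_cosets_adj_proj {S : Set A} (u v : Vtx A) :
    (haar (cosets (period S) S)).Adj (proj (period S) u) (proj (period S) v) ↔
      (haar S).Adj u v := by
  simp only [haar, proj, ← QuotientAddGroup.mk_sub, mk_mem_cosets_period]

/-- The classes of vertices with the same neighbours are the sets `{i} × (x + C)`. -/
theorem forall_adj_iff_proj_eq {S : Set A} (hS : S.Nonempty) {u v : Vtx A} :
    (∀ w, (haar S).Adj u w ↔ (haar S).Adj v w) ↔ proj (period S) u = proj (period S) v := by
  constructor
  · intro h
    obtain ⟨i, x⟩ := u
    obtain ⟨j, y⟩ := v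
    obtain ⟨s, hs⟩ := hS
    have hij : i = j := by
      have hn : ∀ u : Vtx A, ∃ w, (haar S).Adj u w := by
        rintro ⟨i, x⟩
        obtain rfl | rfl := zmodTwo_cases i
        · exact ⟨(1, x + s), by simpa using hs⟩
        · exact ⟨(0, x - s), by simpa using hs⟩
      obtain ⟨w, hw⟩ := hn (i, x)
      have h1 := haar_adj_fst hw
      have h2 := haar_adj_fst ((h w).1 hw)
      exact add_right_cancel (h1.symm.trans h2)
    subst hij
    refine Prod.ext rfl (QuotientAddGroup.eq.2 (mem_period_iff.2 fun z => ?_))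
    obtain rfl | rfl := zmodTwo_cases i
    · have h1 := h (1, y + z)
      simp only [haar_adj_zero_one, add_sub_cancel_left] at h1
      rw [← h1, sub_eq_neg_add, add_assoc]
    · have h1 := h (0, x - z)
      simp only [haar_adj_one_zero, sub_sub_cancel] at h1
      rw [h1]
      abel_nf
  · intro h w
    rw [← haar_cosets_adj_proj, h, haar_cosets_adj_proj]

theorem proj_iso_eq_iff {S V : Set A} (hS : S.Nonempty) (φ : haar S ≃g haar V) {u v : Vtx A} :
    proj (period V) (φ u) = proj (period V) (φ v) ↔ proj (period S) u = proj (period S) v := by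
  rw [← forall_adj_iff_proj_eq hS, ← forall_adj_iff_proj_eq (nonempty_of_iso hS φ),
    φ.surjective.forall]
  simp only [φ.map_adj_iff]

/-- An isomorphism of Haar graphs induces one of the block quotients. -/
theorem nonempty_quotient_iso {S V : Set A} (hS : S.Nonempty) (φ : haar S ≃g haar V) :
    Nonempty (haar (cosets (period S) S) ≃g haar (cosets (period V) V)) := by
  obtain ⟨r, hr⟩ := (proj_surjective (period S)).hasRightInverse
  let f : Vtx (A ⧸ period S) → Vtx (A ⧸ period V) := fun q => proj (period V) (φ (r q))
  have hf : ∀ u, f (proj (period S) u) = proj (period V) (φ u) := fun u =>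
    (proj_iso_eq_iff hS φ).2 (hr _)
  have hbij : Function.Bijective f := by
    constructor
    · intro p q h
      have h1 := (proj_iso_eq_iff hS φ).1 h
      rwa [hr, hr] at h1
    · intro q
      obtain ⟨v, rfl⟩ := proj_surjective _ q
      obtain ⟨u, rfl⟩ := φ.surjective v
      exact ⟨_, hf u⟩
  refine ⟨⟨Equiv.ofBijective f hbij, ?_⟩⟩
  intro p q
  obtain ⟨u, rfl⟩ := proj_surjective _ p
  obtain ⟨v, rfl⟩ := proj_surjective _ q
  simp only [Equiv.ofBijective_apply, hf, haar_cosets_adj_proj, φ.map_adj_iff]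

/-- A member of the automorphism group as a graph isomorphism. -/
def isoOfAut {V : Type*} {Γ : SimpleGraph V} (σ : autGroup Γ) : Γ ≃g Γ where
  toEquiv := σ.1
  map_rel_iff' := σ.2 _ _

theorem isPretransitive_autGroup (S : Set A) :
    MulAction.IsPretransitive (autGroup (haar S)) (Vtx A) := by
  refine ⟨fun u v => ?_⟩
  obtain ⟨φ, hφ⟩ := exists_iso_map_eq S u v
  exact ⟨⟨φ.toEquiv, fun x y => φ.map_rel_iff⟩, hφ⟩

theorem isBlockSystem_blocks {S : Set A} (hS : S.Nonempty) :
    MulAction.IsBlockSystem (autGroup (haar S)) (blocks (period S)) := by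
  refine ⟨⟨?_, ?_⟩, ?_⟩
  · rintro ⟨q, hq⟩
    obtain ⟨u, rfl⟩ := proj_surjective _ q
    have : u ∈ (∅ : Set (Vtx A)) := hq ▸ rfl
    exact this
  · intro u
    refine ⟨_, ⟨⟨proj (period S) u, rfl⟩, rfl⟩, ?_⟩
    rintro _ ⟨⟨q, rfl⟩, hq⟩
    rw [show proj (period S) u = q from hq]
  · rintro _ ⟨q, rfl⟩
    rw [MulAction.isBlock_iff_smul_eq_of_mem]
    intro σ u hu hσu
    have key : ∀ w, proj (period S) (σ • w) = q ↔ proj (period S) w = q := by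
      intro w
      have hu : proj (period S) u = q := hu
      have hσu : proj (period S) (σ • u) = q := hσu
      nth_rewrite 1 [← hσu]
      rw [← hu]
      exact proj_iso_eq_iff hS (isoOfAut σ)
    ext w
    rw [Set.mem_smul_set_iff_inv_smul_mem]
    have := key (σ⁻¹ • w)
    rw [smul_inv_smul] at this
    exact this.symm

theorem reducesToBlockQuotient [Finite A] {S : Set A} (hS : S.Nonempty)
    (hred : Reducible (haar S)) : ReducesToBlockQuotient S := by
  refine ⟨isPretransitive_autGroup S, isBlockSystem_blocks hS, ?_, ?_,
    fun E s => exists_isExtension _ E s, ?_⟩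
  · obtain ⟨u, v, huv, h⟩ := hred
    rw [forall_adj_iff_proj_eq hS] at h
    rintro _ ⟨q, rfl⟩ (hB | hB)
    · -- a nonzero element of the period moves a point within its block
      obtain ⟨w, rfl⟩ := proj_surjective _ q
      have hfst : u.1 = v.1 := (Prod.ext_iff.1 h).1
      refine huv (Prod.ext hfst ?_)
      have hc : -u.2 + v.2 ∈ period S := QuotientAddGroup.eq.1 (congrArg Prod.snd h)
      have h1 : (w.1, w.2 + (-u.2 + v.2)) ∈ proj (period S) ⁻¹' {proj (period S) w} := by
        refine Prod.ext rfl ?_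
        change ((w.2 + (-u.2 + v.2) : A) : A ⧸ period S) = (w.2 : A ⧸ period S)
        rw [QuotientAddGroup.mk_add, (QuotientAddGroup.eq_zero_iff _).2 hc, add_zero]
      have h2 := congrArg Prod.snd (hB h1 (show w ∈ _ from rfl))
      exact (neg_add_eq_zero.1 (by simpa using h2))
    · have h1 : ((q.1 + 1, 0) : Vtx A) ∈ proj (period S) ⁻¹' {q} := by
        rw [show proj (period S) ⁻¹' {q} = Set.univ from hB]
        trivial
      have h2 : q.1 + 1 = q.1 := congrArg Prod.fst h1
      simp at h2
  · have hinj : Function.Injective fun q : Vtx (A ⧸ period S) => proj (period S) ⁻¹' {q} :=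
      fun p q h => Set.singleton_injective ((proj_surjective _).preimage_injective h)
    refine ⟨⟨Equiv.ofInjective _ hinj, ?_⟩, fun q => rfl⟩
    intro p q
    constructor
    · rintro ⟨-, u, rfl, v, rfl, h⟩
      exact (haar_cosets_adj_proj u v).2 h
    · intro h
      refine ⟨fun hpq => h.ne (Equiv.injective _ hpq), ?_⟩
      obtain ⟨u, rfl⟩ := proj_surjective _ p
      obtain ⟨v, rfl⟩ := proj_surjective _ q
      exact ⟨u, rfl, v, rfl, (haar_cosets_adj_proj u v).1 h⟩
  · intro 𝒮 h𝒮 𝒯 h𝒯 hext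
    refine ⟨⟨?_, ?_⟩, Set.subset_union_left⟩
    · rintro V ⟨φ⟩
      obtain ⟨s, hs, hsV⟩ := (h𝒮 (period V)).covers _ (nonempty_quotient_iso hS φ)
      obtain ⟨t, ht, hst⟩ := hext _ s hs
      refine ⟨t, Or.inr ht, image_eq_iff.2 fun u v => ?_⟩
      rw [← haar_cosets_adj_proj, hst, hst, image_eq_iff.1 hsV, haar_cosets_adj_proj]
    · rintro σ (hσ | hσ)
      · exact normalized_of_mem_isoSet hσ
      · exact (h𝒯 σ hσ).1

end BlockQuotient

end HaarIso

theorem mainTheorem1 {A : Type*} [AddCommGroup A] [Finite A] (S : Set A) (hS : S.Nonempty)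
    (hst : ¬ HaarIso.NontriviallyUnstable S) :
    (¬ (HaarIso.haar S).Connected ∧
      (∃ a : A, (HaarIso.haar S).Reachable (0, 0) (1, -a)) ∧
      ∀ a : A, (HaarIso.haar S).Reachable (0, 0) (1, -a) → HaarIso.ReducesToComponent S a) ∨
    ((HaarIso.haar S).Connected ∧ HaarIso.Reducible (HaarIso.haar S) ∧
      HaarIso.ReducesToBlockQuotient S) ∨
    ((HaarIso.haar S).Connected ∧
      (∃ a : A, HaarIso.StableAt S a) ∧
      ∀ a : A, HaarIso.StableAt S a → HaarIso.ReducesToCayley S a) := by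
  by_cases hcon : (HaarIso.haar S).Connected
  · by_cases hred : HaarIso.Reducible (HaarIso.haar S)
    · exact Or.inr (Or.inl ⟨hcon, hred, HaarIso.reducesToBlockQuotient hS hred⟩)
    · refine Or.inr (Or.inr ⟨hcon, ?_, fun a ha => ha.reducesToCayley hcon⟩)
      have htop := HaarIso.diffSubgroup_eq_top hS hcon
      by_contra hun
      exact hst ⟨HaarIso.diConnected_cayley htop, HaarIso.not_diBipartite_cayley hS htop,
        by_contra fun h => hred (HaarIso.reducible_haar_of_not_diTwinFree h), hun⟩
  · refine Or.inl ⟨hcon, ?_, fun a ha => HaarIso.reducesToComponent hS hcon ha⟩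
    obtain ⟨s, hs⟩ := hS
    refine ⟨-s, SimpleGraph.Adj.reachable ?_⟩
    simpa using hs
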